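/- Let $n \ge 0$ be an integer. A sphere packing $\mathcal P$ in $\mathbb{R}^n$ is the union of a nonempty collection of closed balls, all of the same radius $\rho>0$, whose interiors are pairwise disjoint. Its upper density is $$\limsup_{R\to\infty}\frac{\operatorname{vol}\big(B_R^n(0)\cap\mathcal P\big)}{\operatorname{vol}\big(B_R^n(0)\big)},$$ where $B_R^n(x)$ is the closed Euclidean ball of radius $R$ about $x$, and the sphere packing density $\Delta_{\mathbb{R}^n}$ is the supremum of the upper densities of all sphere packings in $\mathbb{R}^n$. The Fourier transform of an integrable function $f$ is $\widehat f(y)=\int_{\mathbb{R}^n} f(x)e^{-2\pi i\langle x,y\rangle}\,dx$. **Theorem (Cohn–Elkies linear programming bound).** Let $f\colon\mathbb{R}^n\to\mathbb{R}$ be a Schwartz function and $r$ a positive real number such that $f(0)=\widehat f(0)>0$, $\widehat f(y)\ge 0$ (in particular $\widehat f(y)$ is real) for all $y\in\mathbb{R}^n$, and $f(x)\le 0$ for all $x\in\mathbb{R}^n$ with $|x|\ge r$. Then $$\Delta_{\mathbb{R}^n}\le \operatorname{vol}\big(B_{r/2}^n(0)\big).$$ -/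

import Mathlib

open scoped FourierTransform ComplexOrder SchwartzMap

noncomputable section

/-- A sphere packing in `ℝⁿ`: a nonempty collection of congruent closed balls (of some common
radius `radius > 0`, with the given centers) whose interiors are pairwise disjoint. -/
structure SpherePacking (n : ℕ) where
  /-- The centers of the balls. -/
  centers : Set (EuclideanSpace ℝ (Fin n))
  /-- The common radius of the balls. -/
  radius : ℝ
  radius_pos : 0 < radius
  nonempty : centers.Nonempty
  disjoint_interiors : centers.Pairwise fun x y =>
    Disjoint (interior (Metric.closedBall x radius)) (interior (Metric.closedBall y radius))

/-- The subset of `ℝⁿ` covered by the balls of the packing. -/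
def SpherePacking.carrier {n : ℕ} (P : SpherePacking n) : Set (EuclideanSpace ℝ (Fin n)) :=
  ⋃ x ∈ P.centers, Metric.closedBall x P.radius

/-- The upper density of a packing:
`limsup_{R → ∞} vol (B_R(0) ∩ P) / vol (B_R(0))`, as an extended nonnegative real. -/
def SpherePacking.upperDensity {n : ℕ} (P : SpherePacking n) : ENNReal :=
  Filter.limsup (fun R : ℝ =>
    MeasureTheory.volume (Metric.closedBall (0 : EuclideanSpace ℝ (Fin n)) R ∩ P.carrier) /
      MeasureTheory.volume (Metric.closedBall (0 : EuclideanSpace ℝ (Fin n)) R)) Filter.atTop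

/-- The sphere packing density of `ℝⁿ`: the supremum of the upper densities of all sphere
packings. -/
def spherePackingDensity (n : ℕ) : ENNReal :=
  ⨆ P : SpherePacking n, P.upperDensity

/-- The Fourier transform `f̂(y) = ∫ f(x) exp(-2πi⟨x, y⟩) dx` of a real-valued function on `ℝⁿ`,
as a complex-valued function. -/
def realFourier {n : ℕ} (f : EuclideanSpace ℝ (Fin n) → ℝ) : EuclideanSpace ℝ (Fin n) → ℂ :=
  𝓕 (fun x => (f x : ℂ))

end

/-! Since `f` is the inverse transform of a nonnegative function, it is positive definite: the
energy `∬ f(x - y) dν dν` of a signed measure `ν` is nonnegative (`energy_nonneg`). No periodic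
packings or Poisson summation are needed.

Take `ν = Σ δ_y - c · vol|_B`, with `N` points `y` that are `r`-separated in a ball of radius `T`
and `B` a slightly larger ball of volume `V`. The point-point energy is at most `N f(0)`, because
off-diagonal terms are nonpositive. As `∫ f = f(0)`, up to boundary errors the cross energy is `N
f(0)` and the self-energy of `B` is `V f(0)`. With `c = N / V` this gives `0 ≤ f(0) (N - N² / V)`,
so `N ≤ V` asymptotically (`exists_eventually_card_le`). Scaled to balls of radius `r / 2`, a
packing thus has at most about one center per unit volume, so its density is at most the volume of
one ball. -/

open MeasureTheory Filter Topology

/-! ### Positive definiteness -/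

section PositiveDefinite

variable {E : Type*} [NormedAddCommGroup E] [InnerProductSpace ℝ E] [FiniteDimensional ℝ E]
  [MeasurableSpace E] [BorelSpace E]

/-- The Fourier–Stieltjes transform of a measure, with the sign convention of the inverse Fourier
transform. -/
noncomputable def stieltjesFourier (α : Measure E) (t : E) : ℂ := ∫ x, ((𝐞 (inner ℝ t x) : Circle) : ℂ) ∂α

theorem continuous_fourierChar_inner {E : Type*} [NormedAddCommGroup E]
    [InnerProductSpace ℝ E] :
    Continuous fun p : E × E => ((𝐞 (inner ℝ p.1 p.2) : Circle) : ℂ) :=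
  continuous_subtype_val.comp (Real.continuous_fourierChar.comp continuous_inner)

theorem norm_stieltjesFourier_le {E : Type*} [NormedAddCommGroup E] [InnerProductSpace ℝ E]
    [MeasurableSpace E] (α : Measure E) [IsFiniteMeasure α] (t : E) :
    ‖stieltjesFourier α t‖ ≤ α.real Set.univ := by
  refine (norm_integral_le_of_norm_le_const (C := 1)
    (ae_of_all _ fun x => (Circle.norm_coe _).le)).trans_eq (one_mul _)

theorem stronglyMeasurable_stieltjesFourier (α : Measure E) [SFinite α] :
    StronglyMeasurable (stieltjesFourier α) :=
  continuous_fourierChar_inner.stronglyMeasurable.integral_prod_right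

theorem integrable_mul_stieltjesFourier {h : E → ℂ} (hh : Integrable h) (α β : Measure E)
    [IsFiniteMeasure α] [IsFiniteMeasure β] :
    Integrable fun t => h t * (stieltjesFourier α t * star (stieltjesFourier β t)) := by
  refine hh.mul_bdd (c := α.real Set.univ * β.real Set.univ)
    ((stronglyMeasurable_stieltjesFourier α).mul
      (stronglyMeasurable_stieltjesFourier β).star).aestronglyMeasurable
    (ae_of_all _ fun t => ?_)
  rw [norm_mul, norm_star]
  gcongr <;> exact norm_stieltjesFourier_le _ _

/-- The energy of a pair of finite measures with respect to an inverse Fourier transform. -/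
theorem integral_prod_sub_eq {f h : E → ℂ} (hh : Integrable h)
    (hf : ∀ x, f x = ∫ t, ((𝐞 (inner ℝ t x) : Circle) : ℂ) * h t) (α β : Measure E)
    [IsFiniteMeasure α] [IsFiniteMeasure β] :
    ∫ p, f (p.1 - p.2) ∂(α.prod β) =
      ∫ t, h t * (stieltjesFourier α t * star (stieltjesFourier β t)) := by
  simp_rw [hf]
  rw [integral_integral_swap]
  · refine integral_congr_ae (ae_of_all _ fun t => ?_)
    have key : ∀ p : E × E, ((𝐞 (inner ℝ t (p.1 - p.2)) : Circle) : ℂ) * h t =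
        h t * (((𝐞 (inner ℝ t p.1) : Circle) : ℂ) * star ((𝐞 (inner ℝ t p.2) : Circle) : ℂ)) := fun p => by
      rw [inner_sub_right, sub_eq_add_neg, AddChar.map_add_eq_mul, AddChar.map_neg_eq_inv,
        Circle.coe_mul, Circle.coe_inv_eq_conj]
      simp only [RCLike.star_def]
      ring
    simp only [key]
    rw [integral_const_mul, integral_prod_mul (fun x => ((𝐞 (inner ℝ t x) : Circle) : ℂ))
      (fun y => star ((𝐞 (inner ℝ t y) : Circle) : ℂ))]
    congr 2
    exact integral_conj
  · have h1 : Integrable (fun q : (E × E) × E => h q.2) ((α.prod β).prod volume) :=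
      hh.comp_snd _
    refine h1.bdd_mul (c := 1) (Continuous.aestronglyMeasurable ?_) (ae_of_all _ fun q => (Circle.norm_coe _).le)
    exact continuous_fourierChar_inner.comp
      (continuous_snd.prodMk (continuous_fst.fst.sub continuous_fst.snd))

/-- A real transform `h` makes `f (-x)` the conjugate of the real number `f x`. Evenness lets the
two cross energies be identified. -/
theorem apply_neg_of_eq_integral_fourierChar {f : E → ℝ} {h : E → ℂ} (h0 : ∀ t, 0 ≤ h t)
    (hf : ∀ x, (f x : ℂ) = ∫ t, ((𝐞 (inner ℝ t x) : Circle) : ℂ) * h t) (x : E) :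
    f (-x) = f x := by
  have key : (starRingEnd ℂ) (f x : ℂ) = f (-x) := by
    rw [hf x, hf (-x), ← integral_conj]
    refine integral_congr_ae (ae_of_all _ fun t => ?_)
    simp only [map_mul]
    rw [inner_neg_right, AddChar.map_neg_eq_inv, Circle.coe_inv_eq_conj,
      Complex.conj_eq_iff_im.2 (Complex.le_def.1 (h0 t)).2.symm]
  rw [Complex.conj_ofReal] at key
  exact_mod_cast key.symm

/-- Positive definiteness of an inverse Fourier transform of a nonnegative function, tested on
the signed measure `α - c β`. -/
theorem energy_nonneg {f : E → ℝ} {h : E → ℂ} (hh : Integrable h) (h0 : ∀ t, 0 ≤ h t)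
    (hf : ∀ x, (f x : ℂ) = ∫ t, ((𝐞 (inner ℝ t x) : Circle) : ℂ) * h t) (α β : Measure E)
    [IsFiniteMeasure α] [IsFiniteMeasure β] (c : ℝ) :
    0 ≤ (∫ p, f (p.1 - p.2) ∂(α.prod α)) - 2 * c * (∫ p, f (p.1 - p.2) ∂(α.prod β))
      + c ^ 2 * ∫ p, f (p.1 - p.2) ∂(β.prod β) := by
  have e := fun μ ν (_ : IsFiniteMeasure μ) (_ : IsFiniteMeasure ν) =>
    (integral_ofReal (𝕜 := ℂ) (f := fun p : E × E => f (p.1 - p.2)) (μ := μ.prod ν)).symm.trans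
      (integral_prod_sub_eq (f := fun x => (f x : ℂ)) hh hf μ ν)
  have i := fun μ ν (_ : IsFiniteMeasure μ) (_ : IsFiniteMeasure ν) =>
    integrable_mul_stieltjesFourier hh μ ν
  have hsymm : ∫ p, f (p.1 - p.2) ∂(α.prod β) = ∫ p, f (p.1 - p.2) ∂(β.prod α) := by
    rw [← integral_prod_swap]
    refine integral_congr_ae (ae_of_all _ fun p => ?_)
    simp only [Prod.fst_swap, Prod.snd_swap]
    rw [← neg_sub p.1 p.2, apply_neg_of_eq_integral_fourierChar h0 hf]
  rw [mul_assoc, two_mul, ← sub_sub]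
  nth_rewrite 2 [hsymm]
  rw [← Complex.zero_le_real]
  push_cast
  have e1 := e α α ‹_› ‹_›
  have e2 := e α β ‹_› ‹_›
  have e3 := e β α ‹_› ‹_›
  have e4 := e β β ‹_› ‹_›
  simp only [Complex.coe_algebraMap] at e1 e2 e3 e4
  have i2 := (i α β ‹_› ‹_›).const_mul (c : ℂ)
  have i3 := (i β α ‹_› ‹_›).const_mul (c : ℂ)
  have i4 := (i β β ‹_› ‹_›).const_mul ((c : ℂ) ^ 2)
  have i12 := (i α α ‹_› ‹_›).sub i2
  rw [e1, e2, e3, e4, ← integral_const_mul, ← integral_const_mul, ← integral_const_mul,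
    ← integral_sub' (i α α ‹_› ‹_›) i2, ← integral_sub' i12 i3, ← integral_add' (i12.sub i3) i4]
  refine integral_nonneg fun t => ?_
  -- The integrand is `h` times the squared modulus of the transform of `α - c β`.
  have : h t * ((stieltjesFourier α t - c * stieltjesFourier β t) *
      star (stieltjesFourier α t - c * stieltjesFourier β t)) =
      h t * (stieltjesFourier α t * star (stieltjesFourier α t))
      - c * (h t * (stieltjesFourier α t * star (stieltjesFourier β t)))
      - c * (h t * (stieltjesFourier β t * star (stieltjesFourier α t)))
      + c ^ 2 * (h t * (stieltjesFourier β t * star (stieltjesFourier β t))) := by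
    simp only [star_sub, star_mul', RCLike.star_def, Complex.conj_ofReal]
    ring
  simp only [Pi.zero_apply, Pi.add_apply, Pi.sub_apply]
  rw [← this]
  exact mul_nonneg (h0 t) (mul_star_self_nonneg _)

end PositiveDefinite

/-! ### Fourier inversion for Schwartz functions -/

section Schwartz

variable {n : ℕ}

theorem realFourier_eq_fourier_postcomp (f : 𝓢(EuclideanSpace ℝ (Fin n), ℝ)) :
    realFourier f =
      ⇑(𝓕 (SchwartzMap.postcompCLM (𝕜 := ℝ) Complex.ofRealCLM f) :
        𝓢(EuclideanSpace ℝ (Fin n), ℂ)) := by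
  rw [SchwartzMap.fourier_coe]
  rfl

theorem integrable_realFourier (f : 𝓢(EuclideanSpace ℝ (Fin n), ℝ)) :
    Integrable (realFourier f) := by
  rw [realFourier_eq_fourier_postcomp]
  exact SchwartzMap.integrable _

theorem ofReal_eq_integral_realFourier (f : 𝓢(EuclideanSpace ℝ (Fin n), ℝ))
    (x : EuclideanSpace ℝ (Fin n)) :
    (f x : ℂ) = ∫ t, ((𝐞 (inner ℝ t x) : Circle) : ℂ) * realFourier f t := by
  set g := SchwartzMap.postcompCLM (𝕜 := ℝ) Complex.ofRealCLM f with hg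
  have h1 : 𝓕⁻ (𝓕 (g : EuclideanSpace ℝ (Fin n) → ℂ)) = g :=
    g.continuous.fourierInv_fourier_eq g.integrable
      (by rw [← SchwartzMap.fourier_coe]; exact (𝓕 g).integrable)
  have h2 := congrFun h1 x
  rw [Real.fourierInv_eq] at h2
  exact h2.symm

theorem realFourier_zero (f : 𝓢(EuclideanSpace ℝ (Fin n), ℝ)) :
    realFourier f 0 = ((∫ x, f x : ℝ) : ℂ) := by
  rw [realFourier, Real.fourier_eq]
  simp only [inner_zero_right, neg_zero, AddChar.map_zero_eq_one, one_smul]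
  exact integral_ofReal

end Schwartz

/-! ### Truncation errors -/

section Tails

variable {E : Type*} [NormedAddCommGroup E] [MeasurableSpace E] [BorelSpace E] {μ : Measure E}
  {f : E → ℝ}

theorem tendsto_setIntegral_compl_closedBall (hf : Integrable f μ) :
    Tendsto (fun k : ℕ => ∫ x in (Metric.closedBall (0 : E) k)ᶜ, |f x| ∂μ) atTop (𝓝 0) := by
  have h := tendsto_setIntegral_of_antitone (μ := μ) (f := fun x => |f x|)
    (s := fun k : ℕ => (Metric.closedBall (0 : E) k)ᶜ)
    (fun k => Metric.isClosed_closedBall.measurableSet.compl)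
    (fun a b hab => Set.compl_subset_compl.2 (Metric.closedBall_subset_closedBall (by simpa)))
    ⟨0, hf.abs.integrableOn⟩
  rw [← Set.compl_iUnion, Metric.iUnion_closedBall_nat] at h
  simpa using h

variable [μ.IsAddLeftInvariant] [μ.IsNegInvariant]

/-- If `z ∉ B` then `y - z` has norm greater than `S`, so only the tail of `f` is lost. -/
theorem abs_setIntegral_sub_integral_le (hf : Integrable f μ) {B : Set E} (hB : MeasurableSet B)
    {y : E} {S : ℝ} (hyB : Metric.closedBall y S ⊆ B) :
    |(∫ z in B, f (y - z) ∂μ) - ∫ z, f z ∂μ| ≤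
      ∫ z in (Metric.closedBall (0 : E) S)ᶜ, |f z| ∂μ := by
  have hfy : Integrable (fun z => f (y - z)) μ := hf.comp_sub_left y
  have hms : MeasurableSet (Metric.closedBall (0 : E) S)ᶜ :=
    Metric.isClosed_closedBall.measurableSet.compl
  rw [← integral_sub_left_eq_self f μ y, ← integral_add_compl hB hfy, sub_add_cancel_left, abs_neg]
  refine abs_integral_le_integral_abs.trans ?_
  rw [← integral_indicator hms, ← integral_sub_left_eq_self _ μ y, ← integral_indicator hB.compl]
  refine integral_mono (hfy.abs.indicator hB.compl)
    ((hf.abs.indicator hms).comp_sub_left y) fun z => ?_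
  by_cases hz : z ∈ B
  · rw [Set.indicator_of_notMem (by simpa using hz)]
    exact Set.indicator_nonneg (fun _ _ => abs_nonneg _) _
  · have : y - z ∈ (Metric.closedBall (0 : E) S)ᶜ := fun h => hz (hyB (by
      simpa [dist_eq_norm, norm_sub_rev] using h))
    rw [Set.indicator_of_mem (by simpa using hz), Set.indicator_of_mem this]

theorem abs_setIntegral_sub_left_le (hf : Integrable f μ) (B : Set E) (y : E) :
    |∫ z in B, f (y - z) ∂μ| ≤ ∫ z, |f z| ∂μ := by
  refine abs_integral_le_integral_abs.trans ?_
  rw [← integral_sub_left_eq_self (fun z => |f z|) μ y]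
  exact setIntegral_le_integral (hf.comp_sub_left y).abs (ae_of_all _ fun _ => abs_nonneg _)

end Tails

/-! ### Counting separated points -/

section Energy

variable {E : Type*} [NormedAddCommGroup E] [InnerProductSpace ℝ E] [FiniteDimensional ℝ E]
  [MeasurableSpace E] [BorelSpace E]

theorem integrable_prod_sub {f : E → ℝ} (hfc : Continuous f) {M : ℝ} (hM : ∀ x, ‖f x‖ ≤ M)
    (α β : Measure E) [IsFiniteMeasure α] [IsFiniteMeasure β] :
    Integrable (fun p : E × E => f (p.1 - p.2)) (α.prod β) :=
  Integrable.of_bound (hfc.comp (continuous_fst.sub continuous_snd)).aestronglyMeasurable M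
    (ae_of_all _ fun _ => hM _)

theorem integral_finset_sum_dirac {g : E → ℝ} (Y : Finset E) :
    ∫ x, g x ∂(∑ y ∈ Y, Measure.dirac y) = ∑ y ∈ Y, g y := by
  rw [integral_finsetSum_measure fun y _ => integrable_dirac (by simp)]
  simp

theorem sum_sum_sub_le {E : Type*} [NormedAddCommGroup E] {f : E → ℝ} {r : ℝ} (hf : ∀ x, r ≤ ‖x‖ → f x ≤ 0) {Y : Finset E}
    (hY : (Y : Set E).Pairwise fun x y => r ≤ dist x y) :
    ∑ x ∈ Y, ∑ y ∈ Y, f (x - y) ≤ Y.card * f 0 := by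
  rw [← nsmul_eq_mul]
  refine Finset.sum_le_card_nsmul _ _ _ fun x hx => ?_
  classical
  rw [← Finset.add_sum_erase _ _ hx, sub_self]
  refine add_le_of_nonpos_right (Finset.sum_nonpos fun y hy => hf _ ?_)
  rw [← dist_eq_norm]
  exact hY hx (Finset.mem_of_mem_erase hy) (Finset.ne_of_mem_erase hy).symm

/-- For `w` in the ball of radius `T`, the inner integral is `∫ f` up to a tail; on the remaining
shell the crude bound `∫ |f|` suffices, as the shell has negligible relative volume. -/
theorem setIntegral_setIntegral_closedBall_le {f : E → ℝ} (hf : Integrable f) (hfc : Continuous f)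
    {M : ℝ} (hM : ∀ x, ‖f x‖ ≤ M) (hF : 0 ≤ ∫ x, f x) {T S : ℝ} (hS : 0 ≤ S) :
    ∫ w in Metric.closedBall (0 : E) (T + S), ∫ z in Metric.closedBall (0 : E) (T + S), f (w - z) ≤
      ((∫ x, f x) + ∫ z in (Metric.closedBall (0 : E) S)ᶜ, |f z|) *
          volume.real (Metric.closedBall (0 : E) T) +
        (∫ x, |f x|) * (volume.real (Metric.closedBall (0 : E) (T + S)) -
          volume.real (Metric.closedBall (0 : E) T)) := by
  set B := Metric.closedBall (0 : E) (T + S)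
  set B₀ := Metric.closedBall (0 : E) T
  have hsub : B₀ ⊆ B := Metric.closedBall_subset_closedBall (by linarith)
  have hB₀ : MeasurableSet B₀ := Metric.isClosed_closedBall.measurableSet
  have hB : MeasurableSet B := Metric.isClosed_closedBall.measurableSet
  have hBfin : volume B < ⊤ := measure_closedBall_lt_top
  have : IsFiniteMeasure (volume.restrict B) := ⟨by simpa using hBfin⟩
  have hint : IntegrableOn (fun w => ∫ z in B, f (w - z)) B :=
    (integrable_prod_sub hfc hM (volume.restrict B) (volume.restrict B)).integral_prod_left
  have hsplit := setIntegral_union Set.disjoint_sdiff_right (hB.diff hB₀)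
    (hint.mono_set hsub) (hint.mono_set Set.sdiff_subset)
  rw [Set.union_sdiff_cancel hsub] at hsplit
  rw [hsplit]
  refine add_le_add ?_ ?_
  · refine (Real.le_norm_self _).trans (norm_setIntegral_le_of_norm_le_const
      ((measure_mono hsub).trans_lt hBfin) fun w hw => ?_)
    have h1 := abs_setIntegral_sub_integral_le (y := w) (S := S) hf hB
      (Metric.closedBall_subset_closedBall' (by
        have : dist w 0 ≤ T := hw
        linarith))
    rw [Real.norm_eq_abs]
    rw [abs_le] at h1 ⊢
    constructor <;> linarith
  · rw [← measureReal_sdiff hsub hB₀ hBfin.ne]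
    exact (Real.le_norm_self _).trans (norm_setIntegral_le_of_norm_le_const
      ((measure_mono Set.sdiff_subset).trans_lt hBfin) fun w _ =>
        abs_setIntegral_sub_left_le hf _ _)

theorem separated_energy_inequality {f : E → ℝ} {h : E → ℂ} (hh : Integrable h)
    (h0 : ∀ t, 0 ≤ h t)
    (hfh : ∀ x, (f x : ℂ) = ∫ t, ((𝐞 (inner ℝ t x) : Circle) : ℂ) * h t)
    (hf : Integrable f) (hfc : Continuous f) {M : ℝ} (hM : ∀ x, ‖f x‖ ≤ M) (hF : 0 ≤ ∫ x, f x)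
    {r : ℝ} (hfr : ∀ x, r ≤ ‖x‖ → f x ≤ 0) {Y : Finset E}
    (hY : (Y : Set E).Pairwise fun x y => r ≤ dist x y) {T S : ℝ} (hS : 0 ≤ S)
    (hYT : ∀ y ∈ Y, ‖y‖ ≤ T) {c : ℝ} (hc : 0 ≤ c) :
    0 ≤ Y.card * f 0
      - 2 * c * (Y.card * ((∫ x, f x) - ∫ z in (Metric.closedBall (0 : E) S)ᶜ, |f z|))
      + c ^ 2 * (((∫ x, f x) + ∫ z in (Metric.closedBall (0 : E) S)ᶜ, |f z|) *
          volume.real (Metric.closedBall (0 : E) T) +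
        (∫ x, |f x|) * (volume.real (Metric.closedBall (0 : E) (T + S)) -
          volume.real (Metric.closedBall (0 : E) T))) := by
  have hB : MeasurableSet (Metric.closedBall (0 : E) (T + S)) :=
    Metric.isClosed_closedBall.measurableSet
  set α : Measure E := ∑ y ∈ Y, Measure.dirac y with hα
  set β : Measure E := volume.restrict (Metric.closedBall (0 : E) (T + S)) with hβ
  have : IsFiniteMeasure α := by rw [hα]; infer_instance
  have : IsFiniteMeasure β := ⟨by simpa [hβ] using measure_closedBall_lt_top⟩
  have key := energy_nonneg hh h0 hfh α β c
  rw [integral_prod _ (integrable_prod_sub hfc hM α α),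
    integral_prod _ (integrable_prod_sub hfc hM α β),
    integral_prod _ (integrable_prod_sub hfc hM β β)] at key
  simp only [hα, integral_finset_sum_dirac] at key
  refine key.trans ?_
  refine add_le_add (sub_le_sub (sum_sum_sub_le hfr hY) ?_) ?_
  · refine mul_le_mul_of_nonneg_left ?_ (by positivity)
    rw [← nsmul_eq_mul]
    refine Finset.card_nsmul_le_sum _ _ _ fun y hy => ?_
    have h1 := abs_setIntegral_sub_integral_le (y := y) (S := S) hf hB
      (Metric.closedBall_subset_closedBall' (by
        rw [dist_zero_right]
        linarith [hYT y hy]))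
    linarith [(abs_le.1 h1).1]
  · exact mul_le_mul_of_nonneg_left
      (setIntegral_setIntegral_closedBall_le hf hfc hM hF hS) (by positivity)

theorem tendsto_measureReal_closedBall_add_div (a : ℝ) {s : ℝ} (hs : 0 < s) :
    Tendsto (fun R : ℝ => volume.real (Metric.closedBall (0 : E) (s * R + a)) /
      volume.real (Metric.closedBall (0 : E) R)) atTop (𝓝 (s ^ Module.finrank ℝ E)) := by
  have hv : 0 < volume.real (Metric.ball (0 : E) 1) :=
    ENNReal.toReal_pos (Metric.measure_ball_pos _ _ one_pos).ne' measure_ball_lt_top.ne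
  have h1 : Tendsto (fun R : ℝ => (s + a / R) ^ Module.finrank ℝ E) atTop
      (𝓝 ((s + 0) ^ Module.finrank ℝ E)) :=
    ((tendsto_const_nhds.div_atTop tendsto_id).const_add s).pow _
  rw [add_zero] at h1
  refine h1.congr' ?_
  have h2 : Tendsto (fun R : ℝ => s * R + a) atTop atTop :=
    tendsto_atTop_add_const_right _ _ (tendsto_id.const_mul_atTop hs)
  filter_upwards [eventually_gt_atTop 0, h2.eventually_ge_atTop 0] with R hR hR'
  rw [Measure.addHaar_real_closedBall _ _ hR.le, Measure.addHaar_real_closedBall _ _ hR',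
    mul_div_mul_right _ _ hv.ne', ← div_pow]
  congr 1
  field_simp

/-- The linear programming bound for the number of points of an `r`-separated set in a large
ball. -/
theorem exists_eventually_card_le {f : E → ℝ} {h : E → ℂ} (hh : Integrable h)
    (h0 : ∀ t, 0 ≤ h t)
    (hfh : ∀ x, (f x : ℂ) = ∫ t, ((𝐞 (inner ℝ t x) : Circle) : ℂ) * h t)
    (hf : Integrable f) (hfc : Continuous f) {M : ℝ} (hM : ∀ x, ‖f x‖ ≤ M)
    (hF : ∫ x, f x = f 0) (hf0 : 0 < f 0)
    {r : ℝ} (hfr : ∀ x, r ≤ ‖x‖ → f x ≤ 0) {κ : ℝ} (hκ : κ < 1) :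
    ∃ S, 0 ≤ S ∧ ∀ᶠ T in atTop, ∀ Y : Finset E,
      ((Y : Set E).Pairwise fun x y => r ≤ dist x y) → (∀ y ∈ Y, ‖y‖ ≤ T) →
      κ * Y.card ≤ volume.real (Metric.closedBall (0 : E) (T + S)) := by
  -- The slack `(1 - κ) f 0` is split in half: one half pays for three tails (two from the cross
  -- term, one from the self-energy of the ball), the other for the shell.
  obtain ⟨k, hk⟩ := ((tendsto_setIntegral_compl_closedBall hf).eventually_lt_const
    (show 0 < (1 - κ) * f 0 / 6 by nlinarith)).exists
  refine ⟨k, k.cast_nonneg, ?_⟩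
  have hlim := tendsto_measureReal_closedBall_add_div (E := E) k one_pos
  simp only [one_mul, one_pow] at hlim
  set L := ∫ x, |f x| with hL
  have hL0 : 0 ≤ L := integral_nonneg fun _ => abs_nonneg _
  have hlim' : Tendsto (fun T : ℝ => L * (volume.real (Metric.closedBall (0 : E) (T + k)) /
      volume.real (Metric.closedBall (0 : E) T) - 1)) atTop (𝓝 0) := by
    simpa using (hlim.sub_const 1).const_mul L
  filter_upwards [hlim'.eventually_lt_const (show 0 < (1 - κ) * f 0 / 2 by nlinarith),
    eventually_gt_atTop 0] with T hT hT0 Y hY hYT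
  have hpos : ∀ {R : ℝ}, 0 < R → 0 < volume.real (Metric.closedBall (0 : E) R) := fun hR =>
    ENNReal.toReal_pos (Metric.measure_closedBall_pos _ _ hR).ne' measure_closedBall_lt_top.ne
  have hV₀ := hpos hT0
  have hV : 0 < volume.real (Metric.closedBall (0 : E) (T + k)) :=
    hpos (by positivity)
  have hVV : volume.real (Metric.closedBall (0 : E) T) ≤
      volume.real (Metric.closedBall (0 : E) (T + k)) :=
    measureReal_mono (Metric.closedBall_subset_closedBall (by simp)) measure_closedBall_lt_top.ne
  have hδ0 : 0 ≤ ∫ z in (Metric.closedBall (0 : E) k)ᶜ, |f z| :=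
    integral_nonneg fun _ => abs_nonneg _
  have key := separated_energy_inequality hh h0 hfh hf hfc hM (hF ▸ hf0.le) hfr hY k.cast_nonneg
    hYT (c := Y.card / volume.real (Metric.closedBall (0 : E) (T + k))) (by positivity)
  rw [hF] at key
  set V := volume.real (Metric.closedBall (0 : E) (T + k))
  set V₀ := volume.real (Metric.closedBall (0 : E) T)
  set δ := ∫ z in (Metric.closedBall (0 : E) k)ᶜ, |f z|
  rcases Y.card.eq_zero_or_pos with hN | hN
  · rw [hN]; simpa using hV.le
  have hN' : (0 : ℝ) < Y.card := by exact_mod_cast hN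
  set N : ℝ := (Y.card : ℝ)
  have hshell : L * (V - V₀) ≤ (1 - κ) * f 0 / 2 * V := by
    have : L * (V - V₀) = L * (V / V₀ - 1) * V₀ := by field_simp
    rw [this]
    exact mul_le_mul hT.le hVV hV₀.le (by nlinarith)
  have hbulk : (f 0 + δ) * V₀ ≤ (f 0 + δ) * V := by gcongr
  have h1 : 0 ≤ N * f 0 - 2 * (N / V) * (N * (f 0 - δ)) +
      (N / V) ^ 2 * ((f 0 + δ) * V + (1 - κ) * f 0 / 2 * V) :=
    key.trans (by gcongr)
  have h2 : N * f 0 - 2 * (N / V) * (N * (f 0 - δ)) +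
      (N / V) ^ 2 * ((f 0 + δ) * V + (1 - κ) * f 0 / 2 * V) =
      N / V * (f 0 * V - N * (f 0 - 3 * δ - (1 - κ) * f 0 / 2)) := by
    field_simp
    ring
  rw [h2] at h1
  have h3 := nonneg_of_mul_nonneg_right h1 (by positivity)
  have h4 : N * (κ * f 0) ≤ N * (f 0 - 3 * δ - (1 - κ) * f 0 / 2) := by
    gcongr
    nlinarith
  have h5 : f 0 * (κ * N) ≤ f 0 * V := by linarith
  exact le_of_mul_le_mul_left h5 hf0

end Energy

/-! ### From point counts to density -/

namespace SpherePacking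

variable {n : ℕ} (P : SpherePacking n)

theorem two_mul_radius_le_dist : P.centers.Pairwise fun x y => 2 * P.radius ≤ dist x y := by
  intro x hx y hy hxy
  by_contra! hlt
  refine Set.disjoint_left.1 (P.disjoint_interiors hx hy hxy)
    (Metric.ball_subset_interior_closedBall (?_ : midpoint ℝ x y ∈ _))
    (Metric.ball_subset_interior_closedBall ?_)
  · rw [Metric.mem_ball, dist_midpoint_left, Real.norm_ofNat]
    linarith
  · rw [Metric.mem_ball, dist_midpoint_right, Real.norm_ofNat]
    linarith

theorem finite_centers_inter_closedBall (R : ℝ) :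
    (Metric.closedBall 0 R ∩ P.centers).Finite := by
  have hr : 0 < 2 * P.radius := by linarith [P.radius_pos]
  have : DiscreteTopology P.centers := .of_forall_le_dist hr fun x y hxy =>
    P.two_mul_radius_le_dist x.2 y.2 (Subtype.coe_injective.ne hxy)
  exact Metric.finite_isBounded_inter_isClosed DiscreteTopology.isDiscrete
    Metric.isBounded_closedBall (Metric.isClosed_of_pairwise_le_dist hr P.two_mul_radius_le_dist)

theorem volume_closedBall_inter_carrier_le (R : ℝ) :
    volume.real (Metric.closedBall 0 R ∩ P.carrier) ≤
      (P.finite_centers_inter_closedBall (R + P.radius)).toFinset.card *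
        volume.real (Metric.closedBall (0 : EuclideanSpace ℝ (Fin n)) P.radius) := by
  set X := (P.finite_centers_inter_closedBall (R + P.radius)).toFinset with hX
  have hsub : Metric.closedBall 0 R ∩ P.carrier ⊆ ⋃ x ∈ X, Metric.closedBall x P.radius := by
    rintro z ⟨hzR, hz⟩
    obtain ⟨x, hx, hzx⟩ := Set.mem_iUnion₂.1 hz
    refine Set.mem_iUnion₂.2 ⟨x, ?_, hzx⟩
    rw [hX, Set.Finite.mem_toFinset]
    refine ⟨?_, hx⟩
    rw [Metric.mem_closedBall] at *
    linarith [dist_triangle_left x 0 z]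
  refine (measureReal_mono hsub ?_).trans ((measureReal_biUnion_finset_le _ _).trans_eq ?_)
  · exact (measure_biUnion_lt_top X.finite_toSet fun _ _ => measure_closedBall_lt_top).ne
  · simp_rw [Measure.addHaar_real_closedBall_center]
    simp

/-- A bound for the number of points of `r`-separated sets in large balls bounds the density. -/
theorem upperDensity_le {r : ℝ} (hr : 0 < r) {κ S : ℝ} (hκ : 0 < κ)
    (h : ∀ᶠ T in atTop, ∀ Y : Finset (EuclideanSpace ℝ (Fin n)),
      ((Y : Set (EuclideanSpace ℝ (Fin n))).Pairwise fun x y => r ≤ dist x y) →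
      (∀ y ∈ Y, ‖y‖ ≤ T) →
      κ * Y.card ≤ volume.real (Metric.closedBall (0 : EuclideanSpace ℝ (Fin n)) (T + S))) :
    P.upperDensity ≤ ENNReal.ofReal
      (κ⁻¹ * volume.real (Metric.closedBall (0 : EuclideanSpace ℝ (Fin n)) (r / 2))) := by
  have hρ := P.radius_pos
  -- Scaling by `s` turns the packing radius into `r / 2`, so the centers become `r`-separated.
  obtain ⟨s, hs0, hs⟩ : ∃ s : ℝ, 0 < s ∧ s * (2 * P.radius) = r :=
    ⟨r / (2 * P.radius), by positivity, by field_simp⟩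
  set v := volume.real (Metric.closedBall (0 : EuclideanSpace ℝ (Fin n)) P.radius) with hv
  have hscale : s ^ Module.finrank ℝ (EuclideanSpace ℝ (Fin n)) * v =
      volume.real (Metric.closedBall (0 : EuclideanSpace ℝ (Fin n)) (r / 2)) := by
    rw [hv, Measure.addHaar_real_closedBall _ _ hρ.le,
      Measure.addHaar_real_closedBall _ _ (by positivity), ← mul_assoc, ← mul_pow]
    congr 2
    linarith
  have hlim := ((tendsto_measureReal_closedBall_add_div (E := EuclideanSpace ℝ (Fin n))
    (s * P.radius + S) hs0).mul_const v).const_mul κ⁻¹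
  rw [hscale] at hlim
  refine (limsup_le_limsup (v := fun R => ENNReal.ofReal (κ⁻¹ *
    (volume.real (Metric.closedBall (0 : EuclideanSpace ℝ (Fin n)) (s * R + (s * P.radius + S))) /
      volume.real (Metric.closedBall (0 : EuclideanSpace ℝ (Fin n)) R) * v))) ?_).trans_eq
    (ENNReal.tendsto_ofReal hlim).limsup_eq
  have hTop : Tendsto (fun R : ℝ => s * (R + P.radius)) atTop atTop :=
    (tendsto_atTop_add_const_right _ _ tendsto_id).const_mul_atTop hs0
  filter_upwards [hTop.eventually h, eventually_gt_atTop 0] with R hR hR0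
  have hVpos : 0 < volume (Metric.closedBall (0 : EuclideanSpace ℝ (Fin n)) R) :=
    Metric.measure_closedBall_pos _ _ hR0
  have hVtop : volume (Metric.closedBall (0 : EuclideanSpace ℝ (Fin n)) R) ≠ ⊤ :=
    measure_closedBall_lt_top.ne
  have hVreal := ENNReal.toReal_pos hVpos.ne' hVtop
  rw [← ENNReal.ofReal_toReal
    ((measure_mono Set.inter_subset_left).trans_lt hVtop.lt_top).ne (a := volume (_ ∩ P.carrier)),
    ← ENNReal.ofReal_toReal hVtop, ← ENNReal.ofReal_div_of_pos hVreal]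
  refine ENNReal.ofReal_le_ofReal ?_
  have hcount := P.volume_closedBall_inter_carrier_le R
  set X := (P.finite_centers_inter_closedBall (R + P.radius)).toFinset with hX
  have hmem : ∀ x ∈ X, ‖x‖ ≤ R + P.radius ∧ x ∈ P.centers := fun x hx => by
    simpa [hX] using hx
  have hY := hR (X.map ⟨(s • ·), smul_right_injective _ hs0.ne'⟩) (by
    intro x hx y hy hxy
    simp only [Finset.coe_map, Function.Embedding.coeFn_mk, Set.mem_image, Finset.mem_coe] at hx hy
    obtain ⟨x, hx, rfl⟩ := hx
    obtain ⟨y, hy, rfl⟩ := hy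
    rw [dist_smul₀, Real.norm_of_nonneg hs0.le, ← hs]
    gcongr
    exact P.two_mul_radius_le_dist (hmem x hx).2 (hmem y hy).2 (by rintro rfl; exact hxy rfl)) (by
    intro y hy
    simp only [Finset.mem_map, Function.Embedding.coeFn_mk] at hy
    obtain ⟨x, hx, rfl⟩ := hy
    rw [norm_smul, Real.norm_of_nonneg hs0.le]
    gcongr
    exact (hmem x hx).1)
  rw [Finset.card_map, mul_add, add_assoc, ← le_inv_mul_iff₀ hκ] at hY
  have hv0 : 0 ≤ v := measureReal_nonneg
  calc _ ≤ X.card * v / volume.real (Metric.closedBall (0 : EuclideanSpace ℝ (Fin n)) R) :=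
        div_le_div_of_nonneg_right hcount hVreal.le
    _ ≤ κ⁻¹ * volume.real (Metric.closedBall (0 : EuclideanSpace ℝ (Fin n))
          (s * R + (s * P.radius + S))) * v /
        volume.real (Metric.closedBall (0 : EuclideanSpace ℝ (Fin n)) R) := by gcongr
    _ = _ := by ring

end SpherePacking

/-- The linear programming bound. For a complex number `z`, `0 ≤ z` means that `z` is real and
nonnegative. -/
theorem mainTheorem1 (n : ℕ) (f : 𝓢(EuclideanSpace ℝ (Fin n), ℝ)) (r : ℝ) (hr : 0 < r)
    (hf0 : (f 0 : ℂ) = realFourier f 0) (hf0_pos : 0 < f 0)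
    (hfourier : ∀ y : EuclideanSpace ℝ (Fin n), 0 ≤ realFourier f y)
    (hf : ∀ x : EuclideanSpace ℝ (Fin n), r ≤ ‖x‖ → f x ≤ 0) :
    spherePackingDensity n ≤
      MeasureTheory.volume (Metric.closedBall (0 : EuclideanSpace ℝ (Fin n)) (r / 2)) := by
  have hF : ∫ x, f x = f 0 := by
    rw [realFourier_zero] at hf0
    exact_mod_cast hf0.symm
  have hW : volume (Metric.closedBall (0 : EuclideanSpace ℝ (Fin n)) (r / 2)) ≠ ⊤ :=
    measure_closedBall_lt_top.ne
  refine iSup_le fun P => ?_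
  have hlim : Tendsto (fun κ : ℝ => ENNReal.ofReal (κ⁻¹ *
      volume.real (Metric.closedBall (0 : EuclideanSpace ℝ (Fin n)) (r / 2)))) (𝓝[<] 1)
      (𝓝 (volume (Metric.closedBall (0 : EuclideanSpace ℝ (Fin n)) (r / 2)))) := by
    have h1 : Tendsto (fun κ : ℝ => κ⁻¹ *
        volume.real (Metric.closedBall (0 : EuclideanSpace ℝ (Fin n)) (r / 2))) (𝓝[<] 1)
        (𝓝 (1⁻¹ * volume.real (Metric.closedBall (0 : EuclideanSpace ℝ (Fin n)) (r / 2)))) :=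
      ((tendsto_inv₀ one_ne_zero).mono_left nhdsWithin_le_nhds).mul_const _
    have h2 := ENNReal.tendsto_ofReal h1
    rwa [inv_one, one_mul, Measure.real, ENNReal.ofReal_toReal hW] at h2
  -- The bound holds with factor `κ⁻¹` for each `κ` in `(0, 1)`; let `κ` tend to `1`.
  refine ge_of_tendsto hlim ?_
  filter_upwards [Ioo_mem_nhdsLT one_pos] with κ hκ
  obtain ⟨S, -, hS⟩ := exists_eventually_card_le (integrable_realFourier f) hfourier
    (ofReal_eq_integral_realFourier f) f.integrable f.continuous
    (fun x => f.toBoundedContinuousFunction.norm_coe_le_norm x) hF hf0_pos hf hκ.2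
  exact P.upperDensity_le hr hκ.1 hS
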